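/- Consider the upper half-space model $H=\{(p_0,\dots,p_n)\in\mathbb R^{n+1} : p_0>0\}$ of hyperbolic space, with the metric $(dp_0^2+\cdots+dp_n^2)/p_0^2$ of curvature $-1$. For $0<h\le 1$ let $H_h=\{p\in H : p_0=h\}$, identified with $\mathbb R^n$ by $q\mapsto (h,q)$; let $N=H_1$ and $U=\{p\in H : 0<p_0<1\}$. For a tangent vector $u$ of $H$ let $\gamma_u:\mathbb R\to H$ be the geodesic with initial velocity $u$. Let $v$ be a smooth unit vector field on $N$ that bifoliates $U$, that is, the geodesic rays $\gamma_{v(p)}((0,\infty))$, $p\in N$, are the leaves of a smooth foliation of $U$, and so are the rays $\gamma_{-v(p)}((0,\infty))$, $p\in N$. Then the outer billiard map $$B:U\to U,\qquad B(\gamma_{v(p)}(-t))=\gamma_{v(p)}(t)\quad (p\in N,\ t>0),$$ is well defined. Moreover, let $0<h<1$ and $r=\sqrt{1-h^2}$, and regard $v$ as a map $\mathbb R^n\to\mathbb R^n$ through the identification $N\simeq\mathbb R^n$. Then $\mathrm{id}-rv:\mathbb R^n\to\mathbb R^n$ is bijective, $B$ maps $H_h$ into itself, and the restriction $B_h$ of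 $B$ to $H_h\simeq\mathbb R^n$ is $$B_h = f\bigl(v\circ(\mathrm{id}-rv)^{-1},\,2r\bigr),\qquad\text{i.e.}\quad B_h(q)=q+2r\,v\bigl((\mathrm{id}-rv)^{-1}(q)\bigr)\quad(q\in\mathbb R^n),$$ where $f(w,\delta)(p)=p+\delta\,w(p)$. -/

import Mathlib

open scoped ContDiff

noncomputable section

/-! ### Riemannian metrics in coordinates and their geodesics -/

/-- The `i`-th partial derivative of a function on `ℝᵐ`. -/
def partialDeriv {m : ℕ} (i : Fin m) (f : EuclideanSpace ℝ (Fin m) → ℝ)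
    (x : EuclideanSpace ℝ (Fin m)) : ℝ :=
  fderiv ℝ f x (EuclideanSpace.single i 1)

/-- The Christoffel symbol `Γᵏᵢⱼ` at `x` of the Levi-Civita connection of the Riemannian metric with
coefficient matrix `g`. -/
def christoffel {m : ℕ} (g : EuclideanSpace ℝ (Fin m) → Matrix (Fin m) (Fin m) ℝ)
    (k i j : Fin m) (x : EuclideanSpace ℝ (Fin m)) : ℝ :=
  (1 / 2) * ∑ l, (g x)⁻¹ k l *
    (partialDeriv i (fun y => g y j l) x + partialDeriv j (fun y => g y i l) x
      - partialDeriv l (fun y => g y i j) x)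

/-- `γ : ℝ → M` is a (complete) geodesic of the open set `M ⊆ ℝᵐ` with the metric `g`. -/
def IsGeodesic {m : ℕ} (M : Set (EuclideanSpace ℝ (Fin m)))
    (g : EuclideanSpace ℝ (Fin m) → Matrix (Fin m) (Fin m) ℝ)
    (γ : ℝ → EuclideanSpace ℝ (Fin m)) : Prop :=
  (∀ t, γ t ∈ M) ∧ ContDiff ℝ 2 γ ∧
    ∀ t k, deriv (deriv γ) t k
      + ∑ i, ∑ j, christoffel g k i j (γ t) * deriv γ t i * deriv γ t j = 0

/-! ### Hyperbolic space and its horospheres -/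

/-- The upper half-space `{p ∈ ℝⁿ⁺¹ | p₀ > 0}`. -/
def upperHalfSpace (n : ℕ) : Set (EuclideanSpace ℝ (Fin (n + 1))) := {p | 0 < p 0}

/-- The hyperbolic metric `(dp₀² + ⋯ + dpₙ²) / p₀²` of curvature `-1` on the upper half-space. -/
def hyperbolicMetric (n : ℕ) (p : EuclideanSpace ℝ (Fin (n + 1))) :
    Matrix (Fin (n + 1)) (Fin (n + 1)) ℝ :=
  Matrix.diagonal fun _ => 1 / (p 0) ^ 2

open Classical in
/-- `hyperbolicGeodesic p u` is the geodesic `γ` of hyperbolic space with `γ(0) = p`, `γ'(0) = u`.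
For `p` in the upper half-space it exists and is unique (hyperbolic space is complete); elsewhere
the value is irrelevant. -/
def hyperbolicGeodesic {n : ℕ} (p u : EuclideanSpace ℝ (Fin (n + 1))) :
    ℝ → EuclideanSpace ℝ (Fin (n + 1)) :=
  if hγ : ∃ γ, IsGeodesic (upperHalfSpace n) (hyperbolicMetric n) γ ∧ γ 0 = p ∧ deriv γ 0 = u then
    hγ.choose
  else fun _ => p

/-- The point `(a, q) ∈ ℝⁿ⁺¹`, for `a ∈ ℝ` and `q ∈ ℝⁿ`. For `h > 0` the map `prepend h` is the
identification of `ℝⁿ` with the horosphere `H_h = {p₀ = h}`, and `prepend 0` is its differential,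
which identifies `ℝⁿ` with the tangent spaces of `H_h`. -/
def prepend {n : ℕ} (a : ℝ) (q : EuclideanSpace ℝ (Fin n)) : EuclideanSpace ℝ (Fin (n + 1)) :=
  WithLp.toLp 2 (Fin.cons a fun i => q i)

/-- The exterior `U = {0 < p₀ < 1}` of the horosphere `N = {p₀ = 1}`. -/
def exterior (n : ℕ) : Set (EuclideanSpace ℝ (Fin (n + 1))) := {p | 0 < p 0 ∧ p 0 < 1}

/-- `v` is a smooth vector field on `N = {p₀ = 1}`, of unit length for the hyperbolic metric; the
vector at the point `(1, p)` is `(0, v p)`. -/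
def IsSmoothUnitField {n : ℕ} (v : EuclideanSpace ℝ (Fin n) → EuclideanSpace ℝ (Fin n)) : Prop :=
  ContDiff ℝ ∞ v ∧
    ∀ p, ∑ i, ∑ j, hyperbolicMetric n (prepend 1 p) i j * prepend 0 (v p) i * prepend 0 (v p) j = 1

/-- `tangentGeodesic v p` is the geodesic with the initial velocity `v` at the point `(1, p)`
of `N`. -/
def tangentGeodesic {n : ℕ} (v : EuclideanSpace ℝ (Fin n) → EuclideanSpace ℝ (Fin n))
    (p : EuclideanSpace ℝ (Fin n)) : ℝ → EuclideanSpace ℝ (Fin (n + 1)) :=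
  hyperbolicGeodesic (prepend 1 p) (prepend 0 (v p))

/-! ### Smooth foliations -/

/-- A smooth foliation, with leaves of dimension `k` and codimension `q`, of the open subset `U` of
a normed space: an atlas of smooth foliated charts onto boxes `A × D`, `A` connected, such that each
change of charts has locally the form `(x, y) ↦ (f(x, y), g(y))`. -/
structure SmoothFoliation {E : Type*} [NormedAddCommGroup E] [NormedSpace ℝ E] (k q : ℕ)
    (U : Set E) where
  atlas : Set (OpenPartialHomeomorph E (EuclideanSpace ℝ (Fin k) × EuclideanSpace ℝ (Fin q)))
  source_subset : ∀ φ ∈ atlas, φ.source ⊆ U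
  covers : ∀ x ∈ U, ∃ φ ∈ atlas, x ∈ φ.source
  smooth : ∀ φ ∈ atlas, ContDiffOn ℝ ∞ φ φ.source
  smooth_symm : ∀ φ ∈ atlas, ContDiffOn ℝ ∞ φ.symm φ.target
  box : ∀ φ ∈ atlas, ∃ (A : Set (EuclideanSpace ℝ (Fin k))) (D : Set (EuclideanSpace ℝ (Fin q))),
    IsOpen A ∧ IsConnected A ∧ IsOpen D ∧ φ.target = A ×ˢ D
  compatible : ∀ φ ∈ atlas, ∀ ψ ∈ atlas, ∀ z ∈ φ.source ∩ ψ.source,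
    ∃ W ⊆ φ.source ∩ ψ.source, IsOpen W ∧ z ∈ W ∧
      ∀ a ∈ W, ∀ b ∈ W, (φ a).2 = (φ b).2 → (ψ a).2 = (ψ b).2

/-- Two points lie on a common plaque `φ⁻¹(A × {y})`. -/
def SmoothFoliation.SamePlaque {E : Type*} [NormedAddCommGroup E] [NormedSpace ℝ E] {k q : ℕ}
    {U : Set E} (F : SmoothFoliation k q U) (a b : E) : Prop :=
  ∃ φ ∈ F.atlas, a ∈ φ.source ∧ b ∈ φ.source ∧ (φ a).2 = (φ b).2

/-- The leaves: the classes in `U` of the equivalence relation of being joined by a finite chain of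
plaques. -/
def SmoothFoliation.leaves {E : Type*} [NormedAddCommGroup E] [NormedSpace ℝ E] {k q : ℕ}
    {U : Set E} (F : SmoothFoliation k q U) : Set (Set E) :=
  {L | ∃ a ∈ U, L = {b | Relation.EqvGen F.SamePlaque a b}}

/-! ### Bifoliating vector fields and outer billiards -/

/-- The geodesic rays `γ_{v(p)}(0, ∞)`, `p ∈ N`, are the leaves of a smooth foliation of `U`. -/
def ForwardFoliates {n : ℕ} (v : EuclideanSpace ℝ (Fin n) → EuclideanSpace ℝ (Fin n)) : Prop :=
  ∃ F : SmoothFoliation 1 n (exterior n),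
    F.leaves = Set.range fun p => tangentGeodesic v p '' Set.Ioi 0

/-- The geodesic rays `γ_{-v(p)}(0, ∞)`, `p ∈ N`, are the leaves of a smooth foliation of `U`. -/
def BackwardFoliates {n : ℕ} (v : EuclideanSpace ℝ (Fin n) → EuclideanSpace ℝ (Fin n)) : Prop :=
  ForwardFoliates fun p => -v p

/-- `v` bifoliates `U`. -/
def Bifoliates {n : ℕ} (v : EuclideanSpace ℝ (Fin n) → EuclideanSpace ℝ (Fin n)) : Prop :=
  ForwardFoliates v ∧ BackwardFoliates v

open Classical in
/-- The outer billiard map `B`, which sends `γ_{v(p)}(-t)` to `γ_{v(p)}(t)` for `p ∈ N`, `t > 0`.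
It is well defined on `U` if `v` bifoliates `U`; elsewhere the value is irrelevant. -/
def outerBilliard {n : ℕ} (v : EuclideanSpace ℝ (Fin n) → EuclideanSpace ℝ (Fin n))
    (x : EuclideanSpace ℝ (Fin (n + 1))) : EuclideanSpace ℝ (Fin (n + 1)) :=
  if hx : ∃ pt : EuclideanSpace ℝ (Fin n) × ℝ, 0 < pt.2 ∧ tangentGeodesic v pt.1 (-pt.2) = x then
    tangentGeodesic v hx.choose.1 hx.choose.2
  else x

/-- The map `f(v, δ)(p) = p + δ v(p)` that generates the `(v, δ)`-flow on `ℝⁿ`. -/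
def flowMap {n : ℕ} (v : EuclideanSpace ℝ (Fin n) → EuclideanSpace ℝ (Fin n)) (δ : ℝ)
    (p : EuclideanSpace ℝ (Fin n)) : EuclideanSpace ℝ (Fin n) :=
  p + δ • v p

end

/-! ### The geodesic equation of the upper half-space -/

section HyperbolicGeodesics

/-! The geodesic through `(1, p)` with horizontal unit velocity `w` is the half circle `t ↦ (1 /
cosh t, p + tanh t • w)` (`hyperbolicGeodesic_eq_hyperbolicArc`). Replacing `t` by `-t` keeps the
height and flips the sign of the horizontal displacement, so `B` preserves each horosphere.

The leaves of a foliation partition `U`. Hence each point of `U` lies on exactly one backward ray,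
at exactly one parameter, which makes `B` well defined. At height `h = 1 / cosh t` one has `tanh t =
r`, and the backward ray from `p` meets `H_h` only in `p - r v(p)`; the partition property thus says
that `id - r v` is bijective (`BackwardFoliates.bijective_sub_smul`). Finally `B` sends `q = p - r
v(p)` to `p + r v(p) = q + 2r v(p)`. -/

theorem hasDerivAt_euclidean_apply {m : ℕ} {γ : ℝ → EuclideanSpace ℝ (Fin m)}
    {γ' : EuclideanSpace ℝ (Fin m)} {t : ℝ} (h : HasDerivAt γ γ' t) (k : Fin m) :
    HasDerivAt (fun s => γ s k) (γ' k) t :=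
  (EuclideanSpace.proj (𝕜 := ℝ) k : EuclideanSpace ℝ (Fin m) →L[ℝ] ℝ).hasFDerivAt.comp_hasDerivAt t h

theorem partialDeriv_hyperbolicMetric {n : ℕ} {p : EuclideanSpace ℝ (Fin (n + 1))} (hp : 0 < p 0)
    (l i j : Fin (n + 1)) :
    partialDeriv l (fun y => hyperbolicMetric n y i j) p =
      if i = j ∧ l = 0 then -2 / (p 0) ^ 3 else 0 := by
  unfold partialDeriv hyperbolicMetric
  by_cases hij : i = j
  · subst hij
    have h0 : HasFDerivAt (fun y : EuclideanSpace ℝ (Fin (n + 1)) => y 0)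
        (EuclideanSpace.proj (𝕜 := ℝ) 0 : EuclideanSpace ℝ (Fin (n + 1)) →L[ℝ] ℝ) p :=
      (EuclideanSpace.proj (𝕜 := ℝ) 0 : EuclideanSpace ℝ (Fin (n + 1)) →L[ℝ] ℝ).hasFDerivAt
    have h1 : HasDerivAt (fun s : ℝ => 1 / s ^ 2) (-2 / (p 0) ^ 3) (p 0) := by
      have := ((hasDerivAt_id (p 0)).pow 2).inv (by simpa using hp.ne')
      simp only [one_div]
      refine this.congr_deriv ?_
      simp only [id, Pi.pow_apply]
      field_simp
      push_cast
      ring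
    have h2 := h1.comp_hasFDerivAt p h0
    simp only [Matrix.diagonal_apply_eq]
    rw [show (fun y : EuclideanSpace ℝ (Fin (n + 1)) => 1 / (y 0) ^ 2) =
      (fun s : ℝ => 1 / s ^ 2) ∘ fun y => y 0 from rfl, h2.fderiv]
    by_cases hl : l = 0
    · subst hl; simp
    · simp [hl, Ne.symm hl]
  · simp [hij]

/-- The metric is conformal and depends on `p 0` only; the common factor is `(1/2) · p₀² · (-2 /
p₀³) = -1 / p₀`. -/
theorem christoffel_hyperbolicMetric {n : ℕ} {p : EuclideanSpace ℝ (Fin (n + 1))} (hp : 0 < p 0)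
    (k i j : Fin (n + 1)) :
    christoffel (hyperbolicMetric n) k i j p =
      -(1 / p 0) * ((if i = 0 then if j = k then 1 else 0 else 0)
        + (if j = 0 then if i = k then 1 else 0 else 0)
        - (if k = 0 then if i = j then 1 else 0 else 0)) := by
  have hinv : (hyperbolicMetric n p)⁻¹ = Matrix.diagonal fun _ => (p 0) ^ 2 := by
    apply Matrix.inv_eq_left_inv
    rw [hyperbolicMetric, Matrix.diagonal_mul_diagonal, ← Matrix.diagonal_one]
    congr 1
    funext
    field_simp
  unfold christoffel
  simp only [partialDeriv_hyperbolicMetric hp, hinv]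
  rw [Finset.sum_eq_single k]
  · rw [Matrix.diagonal_apply_eq]
    split_ifs <;> first | (exfalso; tauto) | (field_simp; try norm_num)
  · intro l _ hl
    rw [Matrix.diagonal_apply_ne _ hl.symm, zero_mul]
  · simp

theorem sum_christoffel_hyperbolicMetric {n : ℕ} {p : EuclideanSpace ℝ (Fin (n + 1))}
    (hp : 0 < p 0) (u : EuclideanSpace ℝ (Fin (n + 1))) (k : Fin (n + 1)) :
    ∑ i, ∑ j, christoffel (hyperbolicMetric n) k i j p * u i * u j =
      -(2 * u 0 * u k - if k = 0 then ∑ i, u i ^ 2 else 0) / p 0 := by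
  have h : ∀ i j, christoffel (hyperbolicMetric n) k i j p * u i * u j =
      -(1 / p 0) * ((if i = 0 then if j = k then u i * u j else 0 else 0)
        + (if j = 0 then if i = k then u i * u j else 0 else 0)
        - (if k = 0 then if i = j then u i * u j else 0 else 0)) := by
    intro i j
    rw [christoffel_hyperbolicMetric hp]
    split_ifs <;> ring
  simp only [h, ← Finset.mul_sum, Finset.sum_add_distrib, Finset.sum_sub_distrib]
  have h3 : ∑ i, ∑ j, (if k = 0 then if i = j then u i * u j else 0 else 0) =
      if k = 0 then ∑ i, u i ^ 2 else 0 := by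
    split_ifs
    · simp [sq]
    · simp
  have h1 : ∑ i, ∑ j, (if i = 0 then if j = k then u i * u j else 0 else 0) = u 0 * u k := by
    rw [Finset.sum_eq_single 0 (fun i _ hi => by simp [hi]) (by simp)]
    simp
  have h2 : ∑ i, ∑ j, (if j = 0 then if i = k then u i * u j else 0 else 0) = u 0 * u k := by
    rw [Finset.sum_comm, Finset.sum_eq_single 0 (fun i _ hi => by simp [hi]) (by simp)]
    simp [mul_comm]
  rw [h1, h2, h3]
  field_simp
  ring

/-- The geodesic equation of hyperbolic space in the upper half-space model. -/
theorem isGeodesic_hyperbolicMetric_iff {n : ℕ} {γ : ℝ → EuclideanSpace ℝ (Fin (n + 1))} :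
    IsGeodesic (upperHalfSpace n) (hyperbolicMetric n) γ ↔
      (∀ t, 0 < γ t 0) ∧ ContDiff ℝ 2 γ ∧ ∀ t k, deriv (deriv γ) t k =
        (2 * deriv γ t 0 * deriv γ t k - if k = 0 then ∑ i, deriv γ t i ^ 2 else 0) / γ t 0 := by
  refine and_congr_right fun hpos => and_congr_right' <|
    forall_congr' fun t => forall_congr' fun k => ?_
  rw [sum_christoffel_hyperbolicMetric (hpos t), neg_div, add_neg_eq_zero]

/-! ### Half circles as geodesics -/

@[simp]
theorem prepend_apply_zero {n : ℕ} (a : ℝ) (q : EuclideanSpace ℝ (Fin n)) : prepend a q 0 = a := rfl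

@[simp]
theorem prepend_apply_succ {n : ℕ} (a : ℝ) (q : EuclideanSpace ℝ (Fin n)) (i : Fin n) :
    prepend a q i.succ = q i := rfl

theorem prepend_inj {n : ℕ} {a b : ℝ} {p q : EuclideanSpace ℝ (Fin n)} :
    prepend a p = prepend b q ↔ a = b ∧ p = q := by
  refine ⟨fun h => ⟨by simpa using congrArg (· 0) h, ?_⟩, fun h => by rw [h.1, h.2]⟩
  ext i
  simpa using congrArg (· i.succ) h

/-- This shape covers both the half circle and, with `p = 0`, its velocity. -/
theorem hasDerivAt_prepend {n : ℕ} {a b : ℝ → ℝ} {a' b' t : ℝ} (p w : EuclideanSpace ℝ (Fin n))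
    (ha : HasDerivAt a a' t) (hb : HasDerivAt b b' t) :
    HasDerivAt (fun s => prepend (a s) (p + b s • w)) (prepend a' (b' • w)) t := by
  have h : ∀ (α β : ℝ) (p : EuclideanSpace ℝ (Fin n)),
      prepend α (p + β • w) = α • prepend 1 0 + β • prepend 0 w + prepend 0 p := by
    intro α β p
    ext i
    refine Fin.cases ?_ (fun i => ?_) i
    · simp
    · simp [add_comm]
  have h0 : prepend a' (b' • w) = a' • prepend 1 0 + b' • prepend 0 w := by
    ext i
    refine Fin.cases ?_ (fun i => ?_) i <;> simp
  simp only [h, h0]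
  exact ((ha.smul_const _).add (hb.smul_const _)).add_const _

theorem hasDerivAt_inv_cosh (t : ℝ) :
    HasDerivAt (fun s => 1 / Real.cosh s) (-Real.sinh t / Real.cosh t ^ 2) t := by
  simpa only [one_div, Pi.inv_apply] using
    (Real.hasDerivAt_cosh t).fun_inv (Real.cosh_pos t).ne'

theorem hasDerivAt_tanh (t : ℝ) : HasDerivAt Real.tanh (1 / Real.cosh t ^ 2) t := by
  rw [show Real.tanh = fun s => Real.sinh s / Real.cosh s from funext Real.tanh_eq_sinh_div_cosh]
  refine ((Real.hasDerivAt_sinh t).fun_div (Real.hasDerivAt_cosh t)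
    (Real.cosh_pos t).ne').congr_deriv ?_
  rw [← Real.cosh_sq_sub_sinh_sq t]
  ring

/-- The half circle through `(1, p)` with the horizontal unit tangent vector `w`. -/
noncomputable def hyperbolicArc {n : ℕ} (p w : EuclideanSpace ℝ (Fin n)) (t : ℝ) :
    EuclideanSpace ℝ (Fin (n + 1)) :=
  prepend (1 / Real.cosh t) (p + Real.tanh t • w)

theorem hasDerivAt_hyperbolicArc {n : ℕ} (p w : EuclideanSpace ℝ (Fin n)) (t : ℝ) :
    HasDerivAt (hyperbolicArc p w)
      (prepend (-Real.sinh t / Real.cosh t ^ 2) ((1 / Real.cosh t ^ 2) • w)) t :=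
  hasDerivAt_prepend p w (hasDerivAt_inv_cosh t) (hasDerivAt_tanh t)

theorem contDiff_hyperbolicArc {n : ℕ} (p w : EuclideanSpace ℝ (Fin n)) :
    ContDiff ℝ 2 (hyperbolicArc p w) := by
  have h : ∀ t, Real.cosh t ≠ 0 := fun t => (Real.cosh_pos t).ne'
  rw [contDiff_euclidean]
  refine Fin.cases ?_ fun i => ?_
  · simp only [hyperbolicArc, prepend_apply_zero]
    exact contDiff_const.div Real.contDiff_cosh h
  · simp only [hyperbolicArc, prepend_apply_succ, PiLp.add_apply, PiLp.smul_apply, smul_eq_mul,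
      Real.tanh_eq_sinh_div_cosh]
    exact contDiff_const.add ((Real.contDiff_sinh.div Real.contDiff_cosh h).mul contDiff_const)

theorem isGeodesic_hyperbolicArc {n : ℕ} (p : EuclideanSpace ℝ (Fin n))
    {w : EuclideanSpace ℝ (Fin n)} (hw : ∑ i, w i ^ 2 = 1) :
    IsGeodesic (upperHalfSpace n) (hyperbolicMetric n) (hyperbolicArc p w) := by
  have hc : ∀ t, Real.cosh t ≠ 0 := fun t => (Real.cosh_pos t).ne'
  refine isGeodesic_hyperbolicMetric_iff.2
    ⟨fun t => one_div_pos.2 (Real.cosh_pos t), contDiff_hyperbolicArc p w, fun t k => ?_⟩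
  have h1 : deriv (hyperbolicArc p w) = fun t =>
      prepend (-Real.sinh t / Real.cosh t ^ 2) (0 + (1 / Real.cosh t ^ 2) • w) := by
    funext t
    rw [zero_add, (hasDerivAt_hyperbolicArc p w t).deriv]
  have ha : HasDerivAt (fun s => -Real.sinh s / Real.cosh s ^ 2)
      ((2 * Real.sinh t ^ 2 - Real.cosh t ^ 2) / Real.cosh t ^ 3) t := by
    refine ((Real.hasDerivAt_sinh t).fun_neg.fun_div ((Real.hasDerivAt_cosh t).fun_pow 2)
      (pow_ne_zero 2 (hc t))).congr_deriv ?_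
    have := hc t
    field_simp
    push_cast
    ring
  have hb : HasDerivAt (fun s => 1 / Real.cosh s ^ 2) (-2 * Real.sinh t / Real.cosh t ^ 3) t := by
    refine ((hasDerivAt_const t (1 : ℝ)).fun_div ((Real.hasDerivAt_cosh t).fun_pow 2)
      (pow_ne_zero 2 (hc t))).congr_deriv ?_
    have := hc t
    field_simp
    push_cast
    ring
  have h2 := (hasDerivAt_prepend 0 w ha hb).deriv
  rw [h1, h2]
  have hS : ∑ i, prepend (-Real.sinh t / Real.cosh t ^ 2) (0 + (1 / Real.cosh t ^ 2) • w) i ^ 2 =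
      1 / Real.cosh t ^ 2 := by
    rw [Fin.sum_univ_succ]
    simp only [prepend_apply_zero, prepend_apply_succ, zero_add, PiLp.smul_apply, smul_eq_mul,
      mul_pow, ← Finset.mul_sum, hw]
    have := hc t
    have := Real.cosh_sq t
    field_simp
    linarith
  rw [hS]
  have := hc t
  refine Fin.cases ?_ (fun i => ?_) k
  · simp only [prepend_apply_zero, hyperbolicArc, if_true]
    field_simp
  · simp only [prepend_apply_zero, prepend_apply_succ, hyperbolicArc, Fin.succ_ne_zero, if_false,
      zero_add, PiLp.smul_apply, smul_eq_mul, sub_zero]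
    field_simp

/-! ### Uniqueness by conserved quantities -/

theorem eq_of_hasDerivAt_zero {f : ℝ → ℝ} (hf : ∀ t, HasDerivAt f 0 t) (t : ℝ) : f t = f 0 :=
  is_const_of_deriv_eq_zero (fun t => (hf t).differentiableAt) (fun t => (hf t).deriv) t 0

/-- Uniqueness of the geodesic through `(1, p)` with horizontal unit initial velocity. -/
theorem IsGeodesic.eq_hyperbolicArc {n : ℕ} {γ : ℝ → EuclideanSpace ℝ (Fin (n + 1))}
    (hγ : IsGeodesic (upperHalfSpace n) (hyperbolicMetric n) γ) {p w : EuclideanSpace ℝ (Fin n)}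
    (hw : ∑ i, w i ^ 2 = 1) (h0 : γ 0 = prepend 1 p) (h0' : deriv γ 0 = prepend 0 w) :
    γ = hyperbolicArc p w := by
  obtain ⟨hpos, hsm, heq⟩ := isGeodesic_hyperbolicMetric_iff.1 hγ
  have hd : ∀ t k, HasDerivAt (fun s => γ s k) (deriv γ t k) t := fun t k =>
    hasDerivAt_euclidean_apply (hsm.differentiable (by norm_num) t).hasDerivAt k
  have hd' : ∀ t k, HasDerivAt (fun s => deriv γ s k)
      ((2 * deriv γ t 0 * deriv γ t k - if k = 0 then ∑ i, deriv γ t i ^ 2 else 0) / γ t 0) t := by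
    intro t k
    rw [← heq]
    have h1 : ContDiff ℝ 1 (deriv γ) := by
      have : ContDiff ℝ (1 + 1) γ := by simpa [one_add_one_eq_two] using hsm
      exact (contDiff_succ_iff_deriv.1 this).2.2
    exact hasDerivAt_euclidean_apply (h1.differentiable (by norm_num) t).hasDerivAt k
  have hne : ∀ t, γ t 0 ≠ 0 := fun t => (hpos t).ne'
  -- The hyperbolic speed is conserved, and it is `1` at time `0`.
  have hS : ∀ t, ∑ i, deriv γ t i ^ 2 = γ t 0 ^ 2 := by
    intro t
    have key : ∀ t, HasDerivAt (fun s => (∑ i, deriv γ s i ^ 2) / γ s 0 ^ 2) 0 t := by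
      intro t
      refine ((HasDerivAt.fun_sum fun i (_ : i ∈ Finset.univ) => (hd' t i).fun_pow 2).fun_div
        ((hd t 0).fun_pow 2) (pow_ne_zero 2 (hne t))).congr_deriv ?_
      have : ∑ i, ((2 : ℕ) : ℝ) * deriv γ t i ^ (2 - 1) * ((2 * deriv γ t 0 * deriv γ t i
          - if i = 0 then ∑ i, deriv γ t i ^ 2 else 0) / γ t 0) =
          2 * deriv γ t 0 * (∑ i, deriv γ t i ^ 2) / γ t 0 := by
        have e : ∀ i, ((2 : ℕ) : ℝ) * deriv γ t i ^ (2 - 1) * ((2 * deriv γ t 0 * deriv γ t i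
            - if i = 0 then ∑ i, deriv γ t i ^ 2 else 0) / γ t 0) =
            4 * deriv γ t 0 / γ t 0 * deriv γ t i ^ 2
              - if i = 0 then 2 * deriv γ t i * (∑ i, deriv γ t i ^ 2) / γ t 0 else 0 := by
          intro i
          split_ifs <;> push_cast <;> ring
        simp only [e, Finset.sum_sub_distrib, ← Finset.mul_sum, Finset.sum_ite_eq', Finset.mem_univ,
          if_true]
        ring
      rw [this]
      have := hne t
      field_simp
      push_cast
      ring
    have h := eq_of_hasDerivAt_zero key t
    simp only [h0, h0', Fin.sum_univ_succ (n := n), prepend_apply_zero, prepend_apply_succ, hw] at h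
    rw [Fin.sum_univ_succ]
    have := hne t
    field_simp at h
    linarith
  -- Momentum conservation for the horizontal translations, which are isometries.
  have hx : ∀ t (k : Fin n), deriv γ t k.succ = w k * γ t 0 ^ 2 := by
    intro t k
    have key : ∀ t, HasDerivAt (fun s => deriv γ s k.succ / γ s 0 ^ 2) 0 t := by
      intro t
      refine ((hd' t k.succ).fun_div ((hd t 0).fun_pow 2) (pow_ne_zero 2 (hne t))).congr_deriv ?_
      have := hne t
      simp only [Fin.succ_ne_zero, if_false]
      field_simp
      push_cast
      ring
    have h := eq_of_hasDerivAt_zero key t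
    simp only [h0, h0', prepend_apply_zero, prepend_apply_succ] at h
    have := hne t
    field_simp at h
    linarith
  -- By unit speed, `y = 1 / γ₀` solves `y'' = y` with `y(0) = 1`, `y'(0) = 0`. Then `(y' - y) eᵗ`
  -- and `(y' + y) e⁻ᵗ` are constant, which forces `y = cosh`.
  have hy : ∀ t, γ t 0 = 1 / Real.cosh t := by
    intro t
    have hw0 : ∀ t, HasDerivAt (fun s => 1 / γ s 0) (-deriv γ t 0 / γ t 0 ^ 2) t := by
      intro t
      simpa only [one_div] using (hd t 0).fun_inv (hne t)
    have hw1 : ∀ t, HasDerivAt (fun s => -deriv γ s 0 / γ s 0 ^ 2) (1 / γ t 0) t := by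
      intro t
      refine ((hd' t 0).fun_neg.fun_div ((hd t 0).fun_pow 2)
        (pow_ne_zero 2 (hne t))).congr_deriv ?_
      have := hne t
      rw [if_pos rfl, hS]
      field_simp
      push_cast
      ring
    have hA := eq_of_hasDerivAt_zero (f := fun s =>
      (-deriv γ s 0 / γ s 0 ^ 2 - 1 / γ s 0) * Real.exp s) (fun t =>
        (((hw1 t).fun_sub (hw0 t)).fun_mul (Real.hasDerivAt_exp t)).congr_deriv (by ring)) t
    have hB := eq_of_hasDerivAt_zero (f := fun s =>
      (-deriv γ s 0 / γ s 0 ^ 2 + 1 / γ s 0) * Real.exp (-s)) (fun t =>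
        (((hw1 t).fun_add (hw0 t)).fun_mul (hasDerivAt_neg t).exp).congr_deriv (by ring)) t
    simp only [h0, h0', prepend_apply_zero] at hA hB
    norm_num [Real.exp_neg] at hA hB
    have he := Real.exp_pos t
    have hc : 1 / γ t 0 = Real.cosh t := by
      rw [Real.cosh_eq, Real.exp_neg]
      have hB' : -deriv γ t 0 / γ t 0 ^ 2 + 1 / γ t 0 = Real.exp t := by
        rw [one_div]
        exact (mul_inv_eq_one₀ he.ne').1 hB
      rw [← one_div] at hA
      have : 1 / γ t 0 * (2 * Real.exp t) = Real.exp t ^ 2 + 1 := by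
        linear_combination Real.exp t * hB' - hA
      rw [eq_div_of_mul_eq (by positivity) this]
      field_simp
    rw [← hc, one_div_one_div]
  funext t
  ext k
  refine Fin.cases (hy t) (fun k => ?_) k
  have h := eq_of_hasDerivAt_zero (f := fun s => γ s k.succ - Real.tanh s * w k) (fun t =>
    ((hd t k.succ).fun_sub ((hasDerivAt_tanh t).mul_const (w k))).congr_deriv
      (by rw [hx, hy]; ring)) t
  simp only [h0, prepend_apply_succ, Real.tanh_zero] at h
  simp only [hyperbolicArc, prepend_apply_succ, PiLp.add_apply, PiLp.smul_apply, smul_eq_mul]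
  linarith

theorem hyperbolicGeodesic_eq_hyperbolicArc {n : ℕ} (p : EuclideanSpace ℝ (Fin n))
    {w : EuclideanSpace ℝ (Fin n)} (hw : ∑ i, w i ^ 2 = 1) :
    hyperbolicGeodesic (prepend 1 p) (prepend 0 w) = hyperbolicArc p w := by
  have hγ : ∃ γ, IsGeodesic (upperHalfSpace n) (hyperbolicMetric n) γ ∧ γ 0 = prepend 1 p ∧
      deriv γ 0 = prepend 0 w :=
    ⟨hyperbolicArc p w, isGeodesic_hyperbolicArc p hw, by simp [hyperbolicArc],
      by simp [(hasDerivAt_hyperbolicArc p w 0).deriv]⟩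
  rw [hyperbolicGeodesic, dif_pos hγ]
  exact hγ.choose_spec.1.eq_hyperbolicArc hw hγ.choose_spec.2.1 hγ.choose_spec.2.2

end HyperbolicGeodesics

/-! ### Foliations by rays and the billiard map -/

section OuterBilliard

/-- At height `1` the metric is Euclidean. This form of the unit condition passes directly to `-v`.
-/
theorem IsSmoothUnitField.sum_sq {n : ℕ} {v : EuclideanSpace ℝ (Fin n) → EuclideanSpace ℝ (Fin n)}
    (hv : IsSmoothUnitField v) (p : EuclideanSpace ℝ (Fin n)) : ∑ i, v p i ^ 2 = 1 := by
  have h := hv.2 p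
  simp only [hyperbolicMetric, Matrix.diagonal_apply, prepend_apply_zero] at h
  simpa [Fin.sum_univ_succ (n := n), sq] using h

theorem tangentGeodesic_eq {n : ℕ} {v : EuclideanSpace ℝ (Fin n) → EuclideanSpace ℝ (Fin n)}
    (hv : ∀ p, ∑ i, v p i ^ 2 = 1) (p : EuclideanSpace ℝ (Fin n)) (t : ℝ) :
    tangentGeodesic v p t = prepend (1 / Real.cosh t) (p + Real.tanh t • v p) :=
  congrFun (hyperbolicGeodesic_eq_hyperbolicArc p (hv p)) t

theorem SmoothFoliation.exists_mem_leaves {E : Type*} [NormedAddCommGroup E] [NormedSpace ℝ E]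
    {k q : ℕ} {U : Set E} (F : SmoothFoliation k q U) {x : E} (hx : x ∈ U) :
    ∃ L ∈ F.leaves, x ∈ L :=
  ⟨_, ⟨x, hx, rfl⟩, Relation.EqvGen.refl x⟩

theorem SmoothFoliation.leaves_eq {E : Type*} [NormedAddCommGroup E] [NormedSpace ℝ E]
    {k q : ℕ} {U : Set E} (F : SmoothFoliation k q U) {L M : Set E} (hL : L ∈ F.leaves)
    (hM : M ∈ F.leaves) {x : E} (hxL : x ∈ L) (hxM : x ∈ M) : L = M := by
  obtain ⟨a, -, rfl⟩ := hL
  obtain ⟨b, -, rfl⟩ := hM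
  have hab : Relation.EqvGen F.SamePlaque a b := .trans _ _ _ hxL (.symm _ _ hxM)
  ext y
  exact ⟨fun h => .trans _ _ _ (.symm _ _ hab) h, fun h => .trans _ _ _ hab h⟩

variable {n : ℕ} {v : EuclideanSpace ℝ (Fin n) → EuclideanSpace ℝ (Fin n)}

theorem ForwardFoliates.exists_tangentGeodesic_eq (hf : ForwardFoliates v)
    {x : EuclideanSpace ℝ (Fin (n + 1))} (hx : x ∈ exterior n) :
    ∃ p t, 0 < t ∧ tangentGeodesic v p t = x := by
  obtain ⟨F, hF⟩ := hf
  obtain ⟨L, hL, hxL⟩ := F.exists_mem_leaves hx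
  rw [hF] at hL
  obtain ⟨p, rfl⟩ := hL
  obtain ⟨t, ht, rfl⟩ := hxL
  exact ⟨p, t, ht, rfl⟩

theorem eq_of_one_div_cosh_eq {s t : ℝ} (hs : 0 < s) (ht : 0 < t)
    (h : 1 / Real.cosh s = 1 / Real.cosh t) : s = t :=
  Real.cosh_injOn hs.le ht.le (by simpa using h)

/-- Leaves sharing a point coincide as sets. Since the height determines the positive parameter, the
two rays then agree parameter by parameter. -/
theorem ForwardFoliates.eq_of_tangentGeodesic_eq (hv : ∀ p, ∑ i, v p i ^ 2 = 1)
    (hf : ForwardFoliates v) {p q : EuclideanSpace ℝ (Fin n)} {s t : ℝ} (hs : 0 < s) (ht : 0 < t)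
    (h : tangentGeodesic v p s = tangentGeodesic v q t) : p = q ∧ s = t := by
  obtain ⟨F, hF⟩ := hf
  have hmem : ∀ p, tangentGeodesic v p '' Set.Ioi 0 ∈ F.leaves := fun p => hF ▸ ⟨p, rfl⟩
  have himg := F.leaves_eq (hmem p) (hmem q) ⟨s, hs, rfl⟩ ⟨t, ht, h.symm⟩
  have hall : ∀ τ : ℝ, 0 < τ → p + Real.tanh τ • v p = q + Real.tanh τ • v q := by
    intro τ hτ
    have : tangentGeodesic v p τ ∈ tangentGeodesic v q '' Set.Ioi 0 := himg ▸ ⟨τ, hτ, rfl⟩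
    obtain ⟨σ, hσ, he⟩ := this
    rw [tangentGeodesic_eq hv, tangentGeodesic_eq hv, prepend_inj] at he
    obtain rfl := eq_of_one_div_cosh_eq hσ hτ he.1
    exact he.2.symm
  refine ⟨?_, ?_⟩
  · have hcont : Continuous Real.tanh :=
      continuous_iff_continuousAt.2 fun t => (hasDerivAt_tanh t).continuousAt
    -- The base point is not on the open ray; it is recovered as the limit `τ → 0⁺`.
    have hlim : ∀ p, Filter.Tendsto (fun τ : ℝ => p + Real.tanh τ • v p) (nhdsWithin 0 (Set.Ioi 0))
        (nhds p) := by
      intro p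
      have hc : Continuous fun τ : ℝ => p + Real.tanh τ • v p := by fun_prop
      simpa using (hc.tendsto 0).mono_left nhdsWithin_le_nhds
    refine tendsto_nhds_unique (hlim p) ((hlim q).congr' ?_)
    filter_upwards [self_mem_nhdsWithin] with τ hτ using (hall τ hτ).symm
  · rw [tangentGeodesic_eq hv, tangentGeodesic_eq hv, prepend_inj] at h
    exact eq_of_one_div_cosh_eq hs ht h.1

theorem tangentGeodesic_mem_exterior (hv : ∀ p, ∑ i, v p i ^ 2 = 1)
    (p : EuclideanSpace ℝ (Fin n)) {t : ℝ} (ht : t ≠ 0) :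
    tangentGeodesic v p t ∈ exterior n := by
  rw [tangentGeodesic_eq hv]
  exact ⟨one_div_pos.2 (Real.cosh_pos t), (div_lt_one (Real.cosh_pos t)).2 (Real.one_lt_cosh.2 ht)⟩

theorem tangentGeodesic_neg (hv : ∀ p, ∑ i, v p i ^ 2 = 1) (p : EuclideanSpace ℝ (Fin n)) (t : ℝ) :
    tangentGeodesic (fun p => -v p) p t = tangentGeodesic v p (-t) := by
  rw [tangentGeodesic_eq hv, tangentGeodesic_eq (by simpa using hv)]
  simp

/-- Uniqueness of the backward ray and parameter through a point makes the choice in `outerBilliard`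
immaterial. -/
theorem BackwardFoliates.outerBilliard_tangentGeodesic (hv : ∀ p, ∑ i, v p i ^ 2 = 1)
    (hb : BackwardFoliates v) (p : EuclideanSpace ℝ (Fin n)) {t : ℝ} (ht : 0 < t) :
    outerBilliard v (tangentGeodesic v p (-t)) = tangentGeodesic v p t := by
  have hx : ∃ pt : EuclideanSpace ℝ (Fin n) × ℝ,
      0 < pt.2 ∧ tangentGeodesic v pt.1 (-pt.2) = tangentGeodesic v p (-t) := ⟨(p, t), ht, rfl⟩
  have h := hx.choose_spec.2
  rw [← tangentGeodesic_neg hv] at h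
  replace h := h.trans (tangentGeodesic_neg hv p t).symm
  obtain ⟨h1, h2⟩ := ForwardFoliates.eq_of_tangentGeodesic_eq (by simpa using hv) hb
    hx.choose_spec.1 ht h
  rw [outerBilliard, dif_pos hx, h1, h2]

theorem BackwardFoliates.exists_tangentGeodesic_neg_eq (hv : ∀ p, ∑ i, v p i ^ 2 = 1)
    (hb : BackwardFoliates v) {x : EuclideanSpace ℝ (Fin (n + 1))} (hx : x ∈ exterior n) :
    ∃ p t, 0 < t ∧ tangentGeodesic v p (-t) = x := by
  obtain ⟨p, t, ht, h⟩ := ForwardFoliates.exists_tangentGeodesic_eq hb hx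
  exact ⟨p, t, ht, by rw [← tangentGeodesic_neg hv, h]⟩

theorem exists_cosh_tanh_eq {h r : ℝ} (h0 : 0 < h) (h1 : h < 1) (hr : r = √(1 - h ^ 2)) :
    ∃ t, 0 < t ∧ 1 / Real.cosh t = h ∧ Real.tanh t = r := by
  have hpos : 0 < 1 - h ^ 2 := by nlinarith
  have hr0 : 0 < r := hr ▸ Real.sqrt_pos.2 hpos
  have hsq : √(1 + (r / h) ^ 2) = 1 / h := by
    rw [Real.sqrt_eq_iff_mul_self_eq_of_pos (by positivity), hr, div_pow, Real.sq_sqrt hpos.le]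
    field_simp
    ring
  -- With `cosh t = 1 / h` and `tanh t = r`, necessarily `sinh t = r / h`.
  refine ⟨Real.arsinh (r / h), Real.arsinh_pos_iff.2 (div_pos hr0 h0), ?_, ?_⟩
  · rw [Real.cosh_arsinh, hsq, one_div_one_div]
  · rw [Real.tanh_arsinh, hsq]
    field_simp

/-- The map records where the backward ray from `p` crosses height `1 / cosh t`: disjointness of the
rays gives injectivity, covering gives surjectivity. -/
theorem BackwardFoliates.bijective_sub_smul (hv : ∀ p, ∑ i, v p i ^ 2 = 1)
    (hb : BackwardFoliates v) {t : ℝ} (ht : 0 < t) :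
    Function.Bijective fun p => p - Real.tanh t • v p := by
  refine ⟨fun p q hpq => ?_, fun q => ?_⟩
  · refine (ForwardFoliates.eq_of_tangentGeodesic_eq (by simpa using hv) hb ht ht ?_).1
    rw [tangentGeodesic_neg hv, tangentGeodesic_neg hv, tangentGeodesic_eq hv,
      tangentGeodesic_eq hv, prepend_inj]
    simpa [sub_eq_add_neg] using hpq
  · obtain ⟨p, s, hs, h⟩ := hb.exists_tangentGeodesic_neg_eq hv
      (x := prepend (1 / Real.cosh t) q) ⟨one_div_pos.2 (Real.cosh_pos t),
        (div_lt_one (Real.cosh_pos t)).2 (Real.one_lt_cosh.2 ht.ne')⟩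
    rw [tangentGeodesic_eq hv, prepend_inj, Real.cosh_neg] at h
    obtain rfl := eq_of_one_div_cosh_eq hs ht h.1
    exact ⟨p, by simpa [sub_eq_add_neg] using h.2⟩

end OuterBilliard

theorem mainTheorem8 (n : ℕ) (v : EuclideanSpace ℝ (Fin n) → EuclideanSpace ℝ (Fin n))
    (hv : IsSmoothUnitField v) (hbi : Bifoliates v) :
    -- the outer billiard map is well defined on `U`
    (∀ x ∈ exterior n, ∃ p t, 0 < t ∧ tangentGeodesic v p (-t) = x) ∧
    (∀ p t, 0 < t → tangentGeodesic v p (-t) ∈ exterior n ∧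
      outerBilliard v (tangentGeodesic v p (-t)) = tangentGeodesic v p t) ∧
    -- its restriction to the horosphere `H_h`
    ∀ h r : ℝ, 0 < h → h < 1 → r = √(1 - h ^ 2) →
      ∃ hinv : Function.Bijective (fun p : EuclideanSpace ℝ (Fin n) => p - r • v p),
        ∀ q : EuclideanSpace ℝ (Fin n),
          outerBilliard v (prepend h q) =
            prepend h (flowMap (v ∘ (Equiv.ofBijective _ hinv).symm) (2 * r) q) := by
  have hu := hv.sum_sq
  have hb := hbi.2
  refine ⟨fun x hx => hb.exists_tangentGeodesic_neg_eq hu hx,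
    fun p t ht => ⟨tangentGeodesic_mem_exterior hu p (neg_ne_zero.2 ht.ne'),
      hb.outerBilliard_tangentGeodesic hu p ht⟩, fun h r h0 h1 hr => ?_⟩
  obtain ⟨t, ht, rfl, rfl⟩ := exists_cosh_tanh_eq h0 h1 hr
  have hinv := hb.bijective_sub_smul hu ht
  refine ⟨hinv, fun q => ?_⟩
  -- Writing `q` as `p - tanh t • v p` turns the inverse map in the formula into `p`.
  obtain ⟨p, rfl⟩ := (Equiv.ofBijective _ hinv).surjective q
  have h := hb.outerBilliard_tangentGeodesic hu p ht
  rw [tangentGeodesic_eq hu, tangentGeodesic_eq hu, Real.cosh_neg, Real.tanh_neg, neg_smul,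
    ← sub_eq_add_neg] at h
  rw [flowMap, Function.comp_apply, Equiv.symm_apply_apply, Equiv.ofBijective_apply, h]
  congr 1
  module
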